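/- **Model.** Let $N\in\mathbb N$, let $E$ (states) and $A$ (actions) be Borel spaces (Borel subsets of Polish spaces), $\mathcal Z$ a measurable space, and $Z_1,\dots,Z_N$ independent $\mathcal Z$-valued random elements on a probability space $(\Omega,\mathcal A,\mathbb P)$. For $n=0,\dots,N-1$ let $D_n\subseteq E\times A$ be measurable and contain the graph of a measurable map $E\to A$, let $D_n(x)=\{a:(x,a)\in D_n\}$, let $T_n:D_n\times\mathcal Z\to E$ be measurable and $c_n:D_n\times E\to\mathbb R_+$; let $c_N:E\to\mathbb R_+$ and $\beta>0$. Assume: (i) the sets $D_n(x)$ are compact, and if $x_k\to x$ and $a_k\in D_n(x_k)$, then $(a_k)$ has an accumulation point in $D_n(x)$; (ii) $(x,a)\mapsto T_n(x,a,z)$ is continuous on $D_n$ for every $z\in\mathcal Z$; (iii) $c_n$ and $c_N$ are lower semicontinuous. Let $g:\mathbb R\to\mathbb R$ be increasing (i.e. nondecreasing) and convex with $g(0)\ge 0$. **Extended model.** Let $\widehat E=E\times\mathbb R_+\times(0,\infty)$ with elements $(x,s,t)$, and for $a\in D_n(x)$ let $$\widehat T_n(x,s,t,a,z)=\big(T_n(x,a,z),\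 s+t\,c_n(x,a,T_n(x,a,z)),\ \beta t\big).$$ Let $\widehat{\mathcal H}_n$ be the set of histories $h_n=(x_0,s_0,t_0,a_0,x_1,s_1,t_1,\dots,a_{n-1},x_n,s_n,t_n)$ with $(x_k,s_k,t_k)\in\widehat E$ for $k\le n$ and $a_k\in D_k(x_k)$ for $k<n$. A policy $\pi=(d_0,\dots,d_{N-1})$ consists of measurable decision rules $d_n:\widehat{\mathcal H}_n\to A$ with $d_n(h_n)\in D_n(x_n)$. It is Markov if $d_n(h_n)=d_n(x_n,s_n,t_n)$ for measurable $d_n:\widehat E\to A$ with $d_n(x,s,t)\in D_n(x)$ (Markov decision rules). Given $\pi$, $n\in\{0,\dots,N\}$ and $h_n\in\widehat{\mathcal H}_n$, let $H_n^\pi=h_n$ and, for $k=n,\dots,N-1$, let $H_{k+1}^\pi$ arise from $H_k^\pi$ by appending the action $d_k(H_k^\pi)$ and the new state $\widehat T_k(\,\cdot\,,d_k(H_k^\pi),Z_{k+1})$, evaluated at the last extended state of $H_k^\pi$; let $X_k^\pi\in E$ be the $E$-component of the last extended state of $H_k^\pi$. Define, with values in $[0,\infty]$, $$V_{n\pi}(h_n)=\mathbb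 E\Big[g\Big(s_n+t_n\Big(\sum_{k=n}^{N-1}\beta^{k-n}c_k(X_k^\pi,d_k(H_k^\pi),X_{k+1}^\pi)+\beta^{N-n}c_N(X_N^\pi)\Big)\Big)\Big],\qquad V_n(h_n)=\inf_\pi V_{n\pi}(h_n),$$ the infimum being over all policies. For $v:\widehat E\to[0,\infty]$ let $L_nv(x,s,t,a)=\mathbb E\big[v(\widehat T_n(x,s,t,a,Z_{n+1}))\big]$ for $a\in D_n(x)$, let $\mathcal T_{nd}v(x,s,t)=L_nv(x,s,t,d(x,s,t))$ for Markov decision rules $d$, and let $\mathcal T_nv(x,s,t)=\inf_{a\in D_n(x)}L_nv(x,s,t,a)$. For a Markov policy $\pi$ let $J_{N\pi}(x,s,t)=g(s+t\,c_N(x))$ and $J_{n\pi}=\mathcal T_{nd_n}J_{n+1,\pi}$ for $n<N$; let $J_n=\inf_\pi J_{n\pi}$ over all Markov policies $\pi$. Let $\mathbb M$ be the set of functions $v:\widehat E\to[0,\infty]$ that are lower semicontinuous, such that $v(x,\cdot,\cdot)$ is increasing for every $x\in E$, and such that $v(x,s,t)\ge g(s)$. **Theorem 4.4.** For $n=0,\dots,N$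 the value function $V_n$ depends only on $(x_n,s_n,t_n)$, namely $V_n(h_n)=J_n(x_n,s_n,t_n)$ for all $h_n\in\widehat{\mathcal H}_n$, and $J_n\in\mathbb M$. Moreover, for all $(x,s,t)\in\widehat E$, $$J_N(x,s,t)=g(s+t\,c_N(x)),\qquad J_n(x,s,t)=\mathcal T_nJ_{n+1}(x,s,t)\quad(n=0,\dots,N-1).$$ For $n=0,\dots,N-1$ there exist Markov decision rules $d_n^*$ with $\mathcal T_{nd_n^*}J_{n+1}=\mathcal T_nJ_{n+1}$, and for every sequence of such minimizers the Markov policy $\pi^*=(d_0^*,\dots,d_{N-1}^*)$ is optimal: $V_{n\pi^*}(h_n)=V_n(h_n)$ for all $n=0,\dots,N$ and $h_n\in\widehat{\mathcal H}_n$. -/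

import Mathlib

open MeasureTheory ProbabilityTheory Filter Topology
open scoped NNReal ENNReal

/-- A finite-horizon Markov decision model in functional form, with horizon `N`, state space `E`,
action space `A`, and disturbances with values in `𝒵` on a probability space `(Ω, P)`.
The data are given for the times `n = 0, …, N - 1`; `Z n` is the disturbance that drives the
transition from time `n` to time `n + 1`. -/
structure DecisionModel (E A 𝒵 : Type*) [MeasurableSpace E] [MeasurableSpace A]
    [MeasurableSpace 𝒵] {Ω : Type*} [MeasurableSpace Ω] (P : Measure Ω) (N : ℕ) where
  /-- the admissible state-action pairs at time `n` -/
  D : Fin N → Set (E × A)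
  measurableSet_D : ∀ n, MeasurableSet (D n)
  /-- `D n` contains the graph of a measurable map -/
  exists_graph : ∀ n, ∃ f : E → A, Measurable f ∧ ∀ x, (x, f x) ∈ D n
  /-- the transition functions -/
  T : ∀ n, D n × 𝒵 → E
  measurable_T : ∀ n, Measurable (T n)
  /-- the one-stage cost functions `c n ((x, a), x')` -/
  c : ∀ n, D n × E → ℝ≥0
  /-- the terminal cost function -/
  cN : E → ℝ≥0
  /-- the disturbances -/
  Z : Fin N → Ω → 𝒵
  measurable_Z : ∀ n, Measurable (Z n)
  indep_Z : iIndepFun Z P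
  /-- the discount factor -/
  β : ℝ≥0
  β_pos : 0 < β

/-- The extended state space `E × [0, ∞) × (0, ∞)`, with elements `(x, s, t)`. -/
abbrev ExtState (E : Type*) : Type _ := E × ℝ≥0 × Set.Ioi (0 : ℝ≥0)

/-- The class `𝕄` of functions on the extended state space: lower semicontinuous, increasing in
`(s, t)`, and bounded below by `g s`. The value `∞` is allowed. -/
def valueClass {E : Type*} [TopologicalSpace E] (g : ℝ → ℝ) : Set (ExtState E → ℝ≥0∞) :=
  {v | LowerSemicontinuous v ∧
    (∀ x : E, Monotone fun p : ℝ≥0 × Set.Ioi (0 : ℝ≥0) => v (x, p)) ∧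
    ∀ (x : E) (s : ℝ≥0) (t : Set.Ioi (0 : ℝ≥0)), ENNReal.ofReal (g s) ≤ v (x, s, t)}

namespace DecisionModel

section

variable {E A 𝒵 Ω : Type*} [MeasurableSpace E] [MeasurableSpace A] [MeasurableSpace 𝒵]
  [MeasurableSpace Ω] {P : Measure Ω} {N : ℕ} (M : DecisionModel E A 𝒵 P N)

/-- The set `D_n(x)` of admissible actions in state `x` at time `n`. -/
def admissible (n : Fin N) (x : E) : Set A := {a | (x, a) ∈ M.D n}

/-- The continuity and compactness assumption. -/
structure ContinuityCompactness [TopologicalSpace E] [TopologicalSpace A] : Prop where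
  isCompact_admissible : ∀ n x, IsCompact (M.admissible n x)
  upperSemicontinuous_admissible : ∀ (n : Fin N) (xs : ℕ → E) (x : E) (as : ℕ → A),
    Tendsto xs atTop (𝓝 x) → (∀ k, as k ∈ M.admissible n (xs k)) →
      ∃ a ∈ M.admissible n x, MapClusterPt a atTop as
  continuous_T : ∀ (n : Fin N) (z : 𝒵), Continuous fun p : M.D n => M.T n (p, z)
  lowerSemicontinuous_c : ∀ n, LowerSemicontinuous (M.c n)
  lowerSemicontinuous_cN : LowerSemicontinuous M.cN

/-- The transition function of the extended model,
`(x, s, t, a, z) ↦ (T_n(x, a, z), s + t c_n(x, a, T_n(x, a, z)), β t)`. -/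
def extT (n : Fin N) (y : ExtState E) (a : M.admissible n y.1) (z : 𝒵) : ExtState E :=
  (M.T n (⟨(y.1, a), a.2⟩, z),
    y.2.1 + y.2.2 * M.c n (⟨(y.1, a), a.2⟩, M.T n (⟨(y.1, a), a.2⟩, z)),
    ⟨M.β * y.2.2, mul_pos M.β_pos y.2.2.2⟩)

/-- The feasible histories `(y_0, a_0, y_1, …, a_{n-1}, y_n)` of the extended model up to time `n`:
the states are arbitrary points of the extended state space, and every action is admissible in
the state in which it is taken. Only `n ≤ N` is used. The σ-algebra is the trace of the product
σ-algebra. -/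
abbrev Hist (n : ℕ) : Type _ :=
  {h : (Fin (n + 1) → ExtState E) × (Fin n → A) //
    ∀ (k : Fin n) (hk : (k : ℕ) < N), h.2 k ∈ M.admissible ⟨k, hk⟩ (h.1 k.castSucc).1}

variable {M} in
/-- The current (last) extended state of a history. -/
def Hist.last {n : ℕ} (h : M.Hist n) : ExtState E := h.1.1 (Fin.last n)

/-- The history `(h, a, y)` obtained from `h` by taking the action `a` and moving to `y`. -/
def append (n : Fin N) (h : M.Hist n) (a : M.admissible n h.last.1) (y : ExtState E) :
    M.Hist (n + 1) :=
  ⟨(Fin.snoc (α := fun _ => ExtState E) h.1.1 y, Fin.snoc (α := fun _ => A) h.1.2 (a : A)), by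
    intro k
    refine Fin.lastCases ?_ (fun i => ?_) k
    · intro hk
      simp only [Fin.snoc_last, Fin.snoc_castSucc]
      exact a.2
    · intro hk
      simp only [Fin.snoc_castSucc]
      exact h.2 i hk⟩

/-- A (history-dependent) decision rule at time `n`. -/
structure Rule (n : Fin N) where
  toFun : M.Hist n → A
  measurable : Measurable toFun
  mem : ∀ h, toFun h ∈ M.admissible n h.last.1

/-- A Markov decision rule at time `n`: it depends on the current extended state only. -/
structure MarkovRule (n : Fin N) where
  toFun : ExtState E → A
  measurable : Measurable toFun
  mem : ∀ y, toFun y ∈ M.admissible n y.1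

/-- A history-dependent `N`-stage policy for the extended model. -/
abbrev Policy : Type _ := ∀ n : Fin N, M.Rule n

/-- A Markov `N`-stage policy for the extended model. -/
abbrev MarkovPolicy : Type _ := ∀ n : Fin N, M.MarkovRule n

variable {M} in
/-- A Markov decision rule as a history-dependent decision rule. -/
def MarkovRule.toRule {n : Fin N} (d : M.MarkovRule n) : M.Rule n where
  toFun h := d.toFun h.last
  measurable :=
    d.measurable.comp ((measurable_pi_apply (Fin.last _)).comp
      (measurable_fst.comp measurable_subtype_coe))
  mem h := d.mem h.last

variable {M} in
/-- A Markov policy as a history-dependent policy. -/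
def MarkovPolicy.toPolicy (π : M.MarkovPolicy) : M.Policy := fun n => (π n).toRule

variable {M}

/-- The history process `H_{n+j}^π`, `j = 0, …, N - n`, of the extended model under the policy `π`,
started at time `n` in the history `h`, in the scenario `ω`. -/
def histProcess (π : M.Policy) (n : ℕ) (h : M.Hist n) (ω : Ω) :
    (j : ℕ) → n + j ≤ N → M.Hist (n + j)
  | 0, _ => h
  | j + 1, hj =>
      let k : Fin N := ⟨n + j, hj⟩
      let H : M.Hist k := histProcess π n h ω j (Nat.le_of_succ_le hj)
      let a : M.admissible k H.last.1 := ⟨(π k).toFun H, (π k).mem H⟩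
      M.append k H a (M.extT k H.last a (M.Z k ω))

/-- The discounted cost from time `n` on under `π`, when the history at time `n` is `h`:
`∑_{k=n}^{N-1} β^{k-n} c_k(X_k, d_k(H_k), X_{k+1}) + β^{N-n} c_N(X_N)`, with `k = n + j`. -/
def costToGo (π : M.Policy) (n : ℕ) (hn : n ≤ N) (h : M.Hist n) (ω : Ω) : ℝ≥0 :=
  ∑ j : Fin (N - n),
    (let k : Fin N := ⟨n + j, by omega⟩
     let H : M.Hist k := histProcess π n h ω j (by omega)
     let H' : M.Hist (n + (j + 1)) := histProcess π n h ω (j + 1) (by omega)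
     M.β ^ (j : ℕ) * M.c k (⟨(H.last.1, (π k).toFun H), (π k).mem H⟩, H'.last.1))
  + M.β ^ (N - n) * M.cN (histProcess π n h ω (N - n) (by omega)).last.1

/-- The value `V_{nπ}(h_n)` of a policy. The conditional expectation given the history `h_n` at
time `n` is the expectation over the scenarios of the process started at time `n` in `h_n`. -/
noncomputable def policyValue (g : ℝ → ℝ) (π : M.Policy) (n : ℕ) (hn : n ≤ N) (h : M.Hist n) :
    ℝ≥0∞ :=
  ∫⁻ ω, ENNReal.ofReal
    (g (h.last.2.1 + (h.last.2.2 : ℝ≥0) * costToGo π n hn h ω : ℝ≥0)) ∂P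

variable (M)

/-- The value function `V_n(h_n) = inf_π V_{nπ}(h_n)`, over all history-dependent policies. -/
noncomputable def value (g : ℝ → ℝ) (n : ℕ) (hn : n ≤ N) (h : M.Hist n) : ℝ≥0∞ :=
  ⨅ π : M.Policy, policyValue g π n hn h

/-- The operator `L_n v(x, s, t, a)`. -/
noncomputable def opL (n : Fin N) (v : ExtState E → ℝ≥0∞) (y : ExtState E)
    (a : M.admissible n y.1) : ℝ≥0∞ :=
  ∫⁻ ω, v (M.extT n y a (M.Z n ω)) ∂P

/-- The operator `𝒯_{nd}` of a Markov decision rule `d`. -/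
noncomputable def opRule (n : Fin N) (d : M.MarkovRule n) (v : ExtState E → ℝ≥0∞) :
    ExtState E → ℝ≥0∞ :=
  fun y => M.opL n v y ⟨d.toFun y, d.mem y⟩

/-- The Bellman operator `𝒯_n`. -/
noncomputable def bellman (n : Fin N) (v : ExtState E → ℝ≥0∞) : ExtState E → ℝ≥0∞ :=
  fun y => ⨅ a : M.admissible n y.1, M.opL n v y a

/-- The terminal value `g(s + t c_N(x))`. -/
noncomputable def terminalValue (g : ℝ → ℝ) : ExtState E → ℝ≥0∞ :=
  fun y => ENNReal.ofReal (g (y.2.1 + (y.2.2 : ℝ≥0) * M.cN y.1 : ℝ≥0))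

/-- The value `J_{nπ}` of a Markov policy: `J_{Nπ}(x, s, t) = g(s + t c_N(x))` and
`J_{nπ} = 𝒯_{n d_n} J_{n+1,π}` for `n < N`. -/
noncomputable def markovPolicyValue (g : ℝ → ℝ) (π : M.MarkovPolicy) (n : ℕ) :
    ExtState E → ℝ≥0∞ :=
  if hn : n < N then
    M.opRule ⟨n, hn⟩ (π ⟨n, hn⟩) (markovPolicyValue g π (n + 1))
  else M.terminalValue g
termination_by N - n

/-- The Markov value function `J_n = inf_π J_{nπ}`, over all Markov policies. -/
noncomputable def markovValue (g : ℝ → ℝ) (n : ℕ) : ExtState E → ℝ≥0∞ :=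
  fun y => ⨅ π : M.MarkovPolicy, M.markovPolicyValue g π n y

end

end DecisionModel

/-!
The accumulated discounted cost is a component of the extended state, so the value of a policy is
the expectation of a function of the last state alone, namely of the terminal value `g (s + t c_N)`
at the final extended state (`policyValue_eq_lintegral_terminalValue`). This makes the problem a
Markov decision problem without running costs, solved by backward induction: let `bellmanValue` be
obtained from the terminal value by iterating the Bellman operators.

* The Bellman operator preserves the class `𝕄` (`bellman_mem_valueClass`). If `v` is lower
  semicontinuous and increasing in `s`, then `v` may be composed with the merely lower
  semicontinuous cost component of the transition (`LowerSemicontinuous.comp_prodMk_of_monotone`);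
  Fatou's lemma passes to the expectation, and compactness of the admissible sets passes to the
  infimum over the actions.
* The infimum is attained by a measurable decision rule (`exists_opRule_eq_bellman`). The set of
  states in which some admissible action from a closed set `F` reaches a given level is closed, so
  the set of minimizers depends measurably on the state, and compact-valued measurable
  multifunctions have measurable selections (`IsCompactMeasurable.exists_measurable_selection`).
* The history up to time `n + j` is a function of the disturbances before that time, hence
  independent of the next one. Integrating out the next disturbance
  (`lintegral_last_histProcess_succ`) shows that the expected Bellman value along the history
  process increases with time under every policy and is constant under a Markov policy of
  minimizers. At the final time this yields `bellmanValue ≤ policyValue`, with equality for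
  minimizers; the same comparison for Markov policies identifies `bellmanValue` with the Markov value function.

Convexity of `g` enters only through its continuity.
-/

/-! ### Measurable selection from compact-valued multifunctions -/

/-- A multifunction `K` from a measurable space to a topological space with nonempty compact
values that is measurable in the sense that the set of points at which `K` hits a given closed
set is measurable. -/
structure IsCompactMeasurable {Y A : Type*} [MeasurableSpace Y] [TopologicalSpace A]
    (K : Y → Set A) : Prop where
  isCompact : ∀ y, IsCompact (K y)
  nonempty : ∀ y, (K y).Nonempty
  measurableSet_hits : ∀ F : Set A, IsClosed F → MeasurableSet {y | (K y ∩ F).Nonempty}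

/-- The minimizers of `f` over `K`, as a multifunction. -/
def argminOn {Y A : Type*} (f : Y → A → ℝ≥0∞) (K : Y → Set A) (y : Y) : Set A :=
  {a ∈ K y | ∀ b ∈ K y, f y a ≤ f y b}

section Selection

variable {Y A : Type*} [MeasurableSpace Y] [TopologicalSpace A] {K : Y → Set A}

/-- Minimizing stays within the class of compact-valued measurable multifunctions. -/
theorem IsCompactMeasurable.argminOn (hK : IsCompactMeasurable K) {f : Y → A → ℝ≥0∞}
    (hf : ∀ y, LowerSemicontinuousOn (f y) (K y))
    (hm : ∀ F : Set A, IsClosed F → ∀ r : ℝ≥0∞, MeasurableSet {y | ∃ a ∈ K y ∩ F, f y a ≤ r}) :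
    IsCompactMeasurable (argminOn f K) where
  isCompact y := by
    obtain ⟨a, ha, hmin⟩ := (hf y).exists_isMinOn (hK.nonempty y) (hK.isCompact y)
    have : _root_.argminOn f K y = K y ∩ f y ⁻¹' Set.Iic (f y a) := by
      ext b
      exact ⟨fun hb => ⟨hb.1, hb.2 a ha⟩, fun hb => ⟨hb.1, fun c hc => hb.2.trans (hmin hc)⟩⟩
    rw [this]
    exact (hf y).isCompact_inter_preimage_Iic (hK.isCompact y) _
  nonempty y := by
    obtain ⟨a, ha, hmin⟩ := (hf y).exists_isMinOn (hK.nonempty y) (hK.isCompact y)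
    exact ⟨a, ha, fun b hb => hmin hb⟩
  measurableSet_hits F hF := by
    -- The minimum over `K y ∩ F` equals the minimum over `K y` iff every rational level reached
    -- on `K y` is reached on `K y ∩ F`.
    have key : {y | (_root_.argminOn f K y ∩ F).Nonempty} = {y | (K y ∩ F).Nonempty} ∩
        ⋂ q : ℚ, ({y | ∃ a ∈ K y ∩ Set.univ, f y a ≤ ENNReal.ofReal q}ᶜ ∪
          {y | ∃ a ∈ K y ∩ F, f y a ≤ ENNReal.ofReal q}) := by
      ext y
      simp only [Set.mem_ofPred_eq, Set.mem_inter_iff, Set.mem_iInter, Set.mem_union,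
        Set.mem_compl_iff, Set.inter_univ]
      constructor
      · rintro ⟨a, ⟨haK, hmin⟩, haF⟩
        refine ⟨⟨a, haK, haF⟩, fun q => or_iff_not_imp_left.2 fun h => ?_⟩
        obtain ⟨b, hb, hbq⟩ := not_not.1 h
        exact ⟨a, ⟨haK, haF⟩, (hmin b hb).trans hbq⟩
      · rintro ⟨hne, hq⟩
        obtain ⟨a, ha, hmin⟩ := ((hf y).mono Set.inter_subset_left).exists_isMinOn hne
          ((hK.isCompact y).inter_right hF)
        refine ⟨a, ⟨ha.1, fun b hb => ?_⟩, ha.2⟩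
        by_contra! hlt
        obtain ⟨q, -, h1, h2⟩ := ENNReal.lt_iff_exists_rat_btwn.1 hlt
        rcases hq q with h | ⟨c, hc, hcq⟩
        · exact h ⟨b, hb, h1.le⟩
        · exact (hmin hc).not_gt (hcq.trans_lt h2)
    rw [key]
    exact (hK.measurableSet_hits F hF).inter
      (.iInter fun q => (hm _ isClosed_univ _).compl.union (hm F hF _))

theorem IsCompactMeasurable.argminOn_of_continuous (hK : IsCompactMeasurable K) {f : A → ℝ≥0∞}
    (hf : Continuous f) : IsCompactMeasurable (_root_.argminOn (fun _ => f) K) := by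
  refine hK.argminOn (fun y => hf.lowerSemicontinuous.lowerSemicontinuousOn _) fun F hF r => ?_
  convert hK.measurableSet_hits (F ∩ {a | f a ≤ r}) (hF.inter (isClosed_le hf continuous_const))
    using 2
  ext y
  simp only [Set.mem_ofPred_eq, Set.Nonempty, Set.mem_inter_iff, and_assoc]

theorem IsCompactMeasurable.iInter [T2Space A] {K : ℕ → Y → Set A}
    (hK : ∀ i, IsCompactMeasurable (K i)) (hanti : ∀ i y, K (i + 1) y ⊆ K i y) :
    IsCompactMeasurable (fun y => ⋂ i, K i y) where
  isCompact y := ((hK 0).isCompact y).of_isClosed_subset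
    (isClosed_iInter fun i => ((hK i).isCompact y).isClosed) (Set.iInter_subset _ 0)
  nonempty y := IsCompact.nonempty_iInter_of_sequence_nonempty_isCompact_isClosed _
    (fun i => hanti i y) (fun i => (hK i).nonempty y) ((hK 0).isCompact y)
    fun i => ((hK i).isCompact y).isClosed
  measurableSet_hits F hF := by
    have key : {y | ((⋂ i, K i y) ∩ F).Nonempty} = ⋂ i, {y | (K i y ∩ F).Nonempty} := by
      ext y
      simp only [Set.mem_ofPred_eq, Set.mem_iInter]
      constructor
      · rintro ⟨a, ha, haF⟩ i
        exact ⟨a, Set.mem_iInter.1 ha i, haF⟩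
      · intro h
        rw [Set.iInter_inter]
        exact IsCompact.nonempty_iInter_of_sequence_nonempty_isCompact_isClosed _
          (fun i => Set.inter_subset_inter_left _ (hanti i y)) h
          (((hK 0).isCompact y).inter_right hF)
          fun i => ((hK i).isCompact y).isClosed.inter hF
    rw [key]
    exact .iInter fun i => (hK i).measurableSet_hits F hF

/-- A compact-valued measurable multifunction into a separable metrizable space has a measurable
selection. The values need not lie in a complete space: successively minimizing the distances to
the points of a dense sequence shrinks each value to a single point. -/
theorem IsCompactMeasurable.exists_measurable_selection
    [TopologicalSpace.MetrizableSpace A] [SecondCountableTopology A] [MeasurableSpace A]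
    [BorelSpace A] (hK : IsCompactMeasurable K) : ∃ d : Y → A, Measurable d ∧ ∀ y, d y ∈ K y := by
  let _ := TopologicalSpace.metrizableSpaceMetric A
  rcases isEmpty_or_nonempty Y with hY | ⟨⟨y₀⟩⟩
  · exact ⟨fun y => (hY.false y).elim, measurable_of_empty _, fun y => (hY.false y).elim⟩
  have : Nonempty A := ⟨(hK.nonempty y₀).some⟩
  let f : ℕ → A → ℝ≥0∞ := fun i a => edist a (TopologicalSpace.denseSeq A i)
  have hf : ∀ i, Continuous (f i) := fun i => continuous_id.edist continuous_const
  let G : ℕ → Y → Set A := fun i => Nat.rec K (fun i G => _root_.argminOn (fun _ => f i) G) i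
  have hG : ∀ i, IsCompactMeasurable (G i) := by
    intro i
    induction i with
    | zero => exact hK
    | succ i ih => exact ih.argminOn_of_continuous (hf i)
  have hI := IsCompactMeasurable.iInter hG fun i y a ha => ha.1
  have huniq : ∀ y, ∀ a ∈ ⋂ i, G i y, ∀ b ∈ ⋂ i, G i y, a = b := by
    intro y a ha b hb
    rw [Set.mem_iInter] at ha hb
    have hab : ∀ i, f i a = f i b := fun i =>
      le_antisymm ((ha (i + 1)).2 b (hb i)) ((hb (i + 1)).2 a (ha i))
    have hall : (fun x => edist a x) = fun x => edist b x :=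
      (TopologicalSpace.denseRange_denseSeq A).equalizer (continuous_const.edist continuous_id)
        (continuous_const.edist continuous_id) (funext hab)
    have := congrFun hall b
    simpa using this
  choose d hd using hI.nonempty
  refine ⟨d, measurable_of_isClosed fun F hF => ?_, fun y => Set.mem_iInter.1 (hd y) 0⟩
  convert hI.measurableSet_hits F hF using 1
  ext y
  exact ⟨fun h => ⟨d y, hd y, h⟩, fun ⟨a, ha, haF⟩ => by
    rw [Set.mem_preimage, huniq y _ (hd y) a ha]; exact haF⟩

end Selection

/-! ### Minimization over upper semicontinuous compact multifunctions -/

section Minimization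

variable {Y A : Type*} [TopologicalSpace Y] [TopologicalSpace A] {K : Y → Set A}
  {f : Y → A → ℝ≥0∞}

/-- If sublevel values of `f` are attained along a sequence, then they are attained at its
limit. -/
theorem exists_mem_le_of_tendsto [FirstCountableTopology A]
    (husc : ∀ (ys : ℕ → Y) (y : Y) (as : ℕ → A), Tendsto ys atTop (𝓝 y) →
      (∀ k, as k ∈ K (ys k)) → ∃ a ∈ K y, MapClusterPt a atTop as)
    (hf : LowerSemicontinuousOn (fun p : Y × A => f p.1 p.2) {p | p.2 ∈ K p.1})
    {F : Set A} (hF : IsClosed F) {r : ℝ≥0∞} {ys : ℕ → Y} {y : Y} (hys : Tendsto ys atTop (𝓝 y))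
    (h : ∀ k, ∃ a ∈ K (ys k) ∩ F, f (ys k) a ≤ r) : ∃ a ∈ K y ∩ F, f y a ≤ r := by
  choose as has hle using h
  obtain ⟨a, ha, hcl⟩ := husc ys y as hys fun k => (has k).1
  obtain ⟨ψ, hψ, hlim⟩ := hcl.tendsto_subseq
  refine ⟨a, ⟨ha, hF.mem_of_tendsto hlim (.of_forall fun k => (has _).2)⟩, ?_⟩
  refine lowerSemicontinuousOn_iff_frequently.1 hf (y, a) ha r ?_
  have htend : Tendsto (fun k => (ys (ψ k), as (ψ k))) atTop (𝓝[{p | p.2 ∈ K p.1}] (y, a)) :=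
    tendsto_nhdsWithin_iff.2 ⟨(hys.comp hψ.tendsto_atTop).prodMk_nhds hlim,
      .of_forall fun k => (has _).1⟩
  exact htend.frequently (Eventually.of_forall fun k => hle (ψ k)).frequently

theorem isClosed_exists_mem_le [SequentialSpace Y] [FirstCountableTopology A]
    (husc : ∀ (ys : ℕ → Y) (y : Y) (as : ℕ → A), Tendsto ys atTop (𝓝 y) →
      (∀ k, as k ∈ K (ys k)) → ∃ a ∈ K y, MapClusterPt a atTop as)
    (hf : LowerSemicontinuousOn (fun p : Y × A => f p.1 p.2) {p | p.2 ∈ K p.1})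
    {F : Set A} (hF : IsClosed F) (r : ℝ≥0∞) : IsClosed {y | ∃ a ∈ K y ∩ F, f y a ≤ r} :=
  IsSeqClosed.isClosed fun _ _ h hys => exists_mem_le_of_tendsto husc hf hF hys h

theorem lowerSemicontinuousOn_section
    (hf : LowerSemicontinuousOn (fun p : Y × A => f p.1 p.2) {p | p.2 ∈ K p.1}) (y : Y) :
    LowerSemicontinuousOn (f y) (K y) :=
  hf.comp (g := fun a => (y, a)) (by fun_prop) fun _ ha => ha

/-- The minimum value over an upper semicontinuous compact multifunction is lower
semicontinuous. -/
theorem lowerSemicontinuous_iInf_mem [SequentialSpace Y] [FirstCountableTopology A]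
    (hcomp : ∀ y, IsCompact (K y)) (hne : ∀ y, (K y).Nonempty)
    (husc : ∀ (ys : ℕ → Y) (y : Y) (as : ℕ → A), Tendsto ys atTop (𝓝 y) →
      (∀ k, as k ∈ K (ys k)) → ∃ a ∈ K y, MapClusterPt a atTop as)
    (hf : LowerSemicontinuousOn (fun p : Y × A => f p.1 p.2) {p | p.2 ∈ K p.1}) :
    LowerSemicontinuous fun y => ⨅ a : K y, f y a := by
  rw [lowerSemicontinuous_iff_isClosed_preimage]
  intro r
  convert isClosed_exists_mem_le husc hf isClosed_univ r using 1
  ext y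
  simp only [Set.mem_preimage, Set.mem_Iic, Set.inter_univ, Set.mem_ofPred_eq]
  constructor
  · intro h
    obtain ⟨a, ha, hmin⟩ := (lowerSemicontinuousOn_section hf y).exists_isMinOn (hne y) (hcomp y)
    exact ⟨a, ha, (le_iInf fun b : K y => hmin b.2).trans h⟩
  · rintro ⟨a, ha, h⟩
    exact (iInf_le (fun b : K y => f y b) ⟨a, ha⟩).trans h

/-- Measurable selection of minimizers. -/
theorem exists_measurable_minimizer [SequentialSpace Y] [MeasurableSpace Y]
    [OpensMeasurableSpace Y] [TopologicalSpace.MetrizableSpace A] [SecondCountableTopology A]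
    [MeasurableSpace A] [BorelSpace A]
    (hcomp : ∀ y, IsCompact (K y)) (hne : ∀ y, (K y).Nonempty)
    (husc : ∀ (ys : ℕ → Y) (y : Y) (as : ℕ → A), Tendsto ys atTop (𝓝 y) →
      (∀ k, as k ∈ K (ys k)) → ∃ a ∈ K y, MapClusterPt a atTop as)
    (hf : LowerSemicontinuousOn (fun p : Y × A => f p.1 p.2) {p | p.2 ∈ K p.1}) :
    ∃ d : Y → A, Measurable d ∧ ∀ y, d y ∈ argminOn f K y := by
  have hm : ∀ F : Set A, IsClosed F → ∀ r : ℝ≥0∞,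
      MeasurableSet {y | ∃ a ∈ K y ∩ F, f y a ≤ r} := fun F hF r =>
    (isClosed_exists_mem_le husc hf hF r).measurableSet
  -- At the level `∞`, these are the sets of points at which `K` hits `F`.
  have hK : IsCompactMeasurable K := ⟨hcomp, hne, fun F hF => by
    simpa [Set.Nonempty] using hm F hF ⊤⟩
  exact (hK.argminOn (lowerSemicontinuousOn_section hf) hm).exists_measurable_selection

end Minimization

/-! ### Lower semicontinuity of the Bellman operator -/

/-- A function that is lower semicontinuous on a product and increasing in the last variable stays
lower semicontinuous when a lower semicontinuous function is substituted for that variable. -/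
theorem LowerSemicontinuous.comp_prodMk_of_monotone {X Y α γ : Type*} [TopologicalSpace X]
    [TopologicalSpace Y] [TopologicalSpace α] [LinearOrder α] [OrderTopology α] [Preorder γ]
    {v : X × α → γ} (hv : LowerSemicontinuous v) (hmono : ∀ x, Monotone fun s => v (x, s))
    {x : Y → X} (hx : Continuous x) {s : Y → α} (hs : LowerSemicontinuous s) :
    LowerSemicontinuous fun y => v (x y, s y) := by
  intro y r hr
  -- Truncated at its value at `y`, the function `s` is continuous at `y`.
  have hmin : Tendsto (fun y' => min (s y') (s y)) (𝓝 y) (𝓝 (s y)) := by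
    refine tendsto_order.2 ⟨fun a ha => ?_, fun b hb => ?_⟩
    · filter_upwards [hs y a ha] with y' hy' using lt_min hy' ha
    · exact .of_forall fun y' => (min_le_right _ _).trans_lt hb
  filter_upwards [((hx.tendsto y).prodMk_nhds hmin).eventually (hv (x y, s y) r hr)] with y' hy'
  exact lt_of_lt_of_le hy' (hmono _ (min_le_left _ _))

theorem LowerSemicontinuous.lintegral {X Ω : Type*} [TopologicalSpace X]
    [FirstCountableTopology X] [MeasurableSpace Ω] {P : Measure Ω} {F : X → Ω → ℝ≥0∞}
    (hm : ∀ x, Measurable (F x)) (hF : ∀ ω, LowerSemicontinuous fun x => F x ω) :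
    LowerSemicontinuous fun x => ∫⁻ ω, F x ω ∂P := by
  rw [lowerSemicontinuous_iff_le_liminf]
  exact fun x => (lintegral_mono fun ω => (hF ω).le_liminf x).trans (lintegral_liminf_le hm)

/-- For a function on the extended state space that is increasing in `s`, the component `s` may be
substituted by a merely lower semicontinuous function. -/
theorem LowerSemicontinuous.comp_extState {E Y γ : Type*} [TopologicalSpace E]
    [TopologicalSpace Y] [Preorder γ] {v : ExtState E → γ} (hv : LowerSemicontinuous v)
    (hmono : ∀ x, Monotone fun p : ℝ≥0 × Set.Ioi (0 : ℝ≥0) => v (x, p))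
    {x : Y → E} (hx : Continuous x) {s : Y → ℝ≥0} (hs : LowerSemicontinuous s)
    {t : Y → Set.Ioi (0 : ℝ≥0)} (ht : Continuous t) :
    LowerSemicontinuous fun y => v (x y, s y, t y) :=
  LowerSemicontinuous.comp_prodMk_of_monotone
    (v := fun q : (E × Set.Ioi (0 : ℝ≥0)) × ℝ≥0 => v (q.1.1, q.2, q.1.2))
    (hv.comp (g := fun q : (E × Set.Ioi (0 : ℝ≥0)) × ℝ≥0 => (q.1.1, q.2, q.1.2)) (by fun_prop))
    (fun q _ _ h => hmono q.1 ⟨h, le_rfl⟩) (hx.prodMk ht) hs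

theorem lowerSemicontinuous_add_mul {Y : Type*} [TopologicalSpace Y] {s t c : Y → ℝ≥0}
    (hs : Continuous s) (ht : Continuous t) (hc : LowerSemicontinuous c) :
    LowerSemicontinuous fun y => s y + t y * c y :=
  LowerSemicontinuous.comp_prodMk_of_monotone
    (v := fun q : (ℝ≥0 × ℝ≥0) × ℝ≥0 => q.1.1 + q.1.2 * q.2)
    (Continuous.lowerSemicontinuous (by fun_prop))
    (fun q a b h => by dsimp only; gcongr) (hs.prodMk ht) hc

theorem ConvexOn.continuous_of_univ {g : ℝ → ℝ} (hg : ConvexOn ℝ Set.univ g) : Continuous g :=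
  continuousOn_univ.1 (hg.continuousOn isOpen_univ)

namespace DecisionModel

section Basic

variable {E A 𝒵 Ω : Type*} [MeasurableSpace E] [MeasurableSpace A] [MeasurableSpace 𝒵]
  [MeasurableSpace Ω] {P : Measure Ω} {N : ℕ} {M : DecisionModel E A 𝒵 P N}

theorem admissible_nonempty (M : DecisionModel E A 𝒵 P N) (n : Fin N) (x : E) :
    (M.admissible n x).Nonempty := by
  obtain ⟨f, -, hf⟩ := M.exists_graph n
  exact ⟨f x, hf x⟩

theorem extT_mono (M : DecisionModel E A 𝒵 P N) (n : Fin N) (x : E) (a : M.admissible n x) (z : 𝒵)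
    {p q : ℝ≥0 × Set.Ioi (0 : ℝ≥0)} (h : p ≤ q) :
    (M.extT n (x, p) a z).2 ≤ (M.extT n (x, q) a z).2 := by
  have h1 : p.1 ≤ q.1 := h.1
  have h2 : (p.2 : ℝ≥0) ≤ q.2 := h.2
  refine ⟨?_, ?_⟩
  · simp only [extT]
    gcongr
  · change M.β * (p.2 : ℝ≥0) ≤ M.β * q.2
    gcongr

open Classical in
/-- The function `L_n v`, extended by `∞` to the inadmissible actions. -/
noncomputable def opLExt (M : DecisionModel E A 𝒵 P N) (n : Fin N) (v : ExtState E → ℝ≥0∞)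
    (y : ExtState E) (a : A) : ℝ≥0∞ :=
  if h : a ∈ M.admissible n y.1 then M.opL n v y ⟨a, h⟩ else ∞

theorem opLExt_coe (n : Fin N) (v : ExtState E → ℝ≥0∞) (y : ExtState E)
    (a : M.admissible n y.1) : M.opLExt n v y a = M.opL n v y a := by
  simp [opLExt]

theorem exists_mapClusterPt_admissible [TopologicalSpace E] [TopologicalSpace A]
    (hM : M.ContinuityCompactness) (n : Fin N)
    (ys : ℕ → ExtState E) (y : ExtState E) (as : ℕ → A) (hys : Tendsto ys atTop (𝓝 y))
    (has : ∀ k, as k ∈ M.admissible n (ys k).1) :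
    ∃ a ∈ M.admissible n y.1, MapClusterPt a atTop as :=
  hM.upperSemicontinuous_admissible n (fun k => (ys k).1) y.1 as
    ((continuous_fst.tendsto y).comp hys) has

theorem bellman_le_opRule (n : Fin N) (d : M.MarkovRule n) (v : ExtState E → ℝ≥0∞) :
    M.bellman n v ≤ M.opRule n d v :=
  fun _ => iInf_le _ _

theorem terminalValue_mem_valueClass [TopologicalSpace E] [TopologicalSpace A]
    {g : ℝ → ℝ} (hM : M.ContinuityCompactness) (hg_mono : Monotone g) (hg : Continuous g) :
    M.terminalValue g ∈ valueClass g := by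
  have hG : Continuous fun r : ℝ≥0 => ENNReal.ofReal (g r) :=
    ENNReal.continuous_ofReal.comp (hg.comp NNReal.continuous_coe)
  have hGm : Monotone fun r : ℝ≥0 => ENNReal.ofReal (g r) := fun a b h =>
    ENNReal.ofReal_le_ofReal (hg_mono (NNReal.coe_le_coe.2 h))
  refine ⟨?_, fun x p q hpq => hGm ?_, fun x s t => hGm le_self_add⟩
  · exact hG.comp_lowerSemicontinuous (lowerSemicontinuous_add_mul (by fun_prop)
      (continuous_subtype_val.comp (by fun_prop))
      (hM.lowerSemicontinuous_cN.comp continuous_fst)) hGm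
  · have h1 : p.1 ≤ q.1 := hpq.1
    have h2 : (p.2 : ℝ≥0) ≤ q.2 := hpq.2
    dsimp only
    gcongr

end Basic

section Measurability

variable {E A 𝒵 Ω : Type*}
  [TopologicalSpace E] [SecondCountableTopology E] [MeasurableSpace E] [BorelSpace E]
  [TopologicalSpace A] [SecondCountableTopology A] [MeasurableSpace A] [BorelSpace A]
  [MeasurableSpace 𝒵] [MeasurableSpace Ω]
  {P : Measure Ω} {N : ℕ} {M : DecisionModel E A 𝒵 P N}

/-- The transition function of the extended model is jointly measurable on the graph of the
admissible actions. -/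
theorem measurable_extT (hM : M.ContinuityCompactness) (n : Fin N) :
    Measurable fun q : {p : ExtState E × A // p.2 ∈ M.admissible n p.1.1} × 𝒵 =>
      M.extT n q.1.1.1 ⟨q.1.1.2, q.1.2⟩ q.2 := by
  have hc : Measurable (M.c n) := (hM.lowerSemicontinuous_c n).measurable
  have hp : Measurable fun q : {p : ExtState E × A // p.2 ∈ M.admissible n p.1.1} × 𝒵 =>
      (⟨(q.1.1.1.1, q.1.1.2), q.1.2⟩ : M.D n) := Measurable.subtype_mk (by fun_prop)
  have hT : Measurable fun q : {p : ExtState E × A // p.2 ∈ M.admissible n p.1.1} × 𝒵 =>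
      M.T n (⟨(q.1.1.1.1, q.1.1.2), q.1.2⟩, q.2) :=
    (M.measurable_T n).comp (hp.prodMk measurable_snd)
  have ht : Measurable fun q : {p : ExtState E × A // p.2 ∈ M.admissible n p.1.1} × 𝒵 =>
      (q.1.1.1.2.2 : ℝ≥0) := measurable_subtype_coe.comp (by fun_prop)
  refine hT.prodMk (Measurable.prodMk (Measurable.add (by fun_prop)
    (ht.mul (hc.comp (hp.prodMk hT)))) ?_)
  exact Measurable.subtype_mk (measurable_const.mul ht)

theorem measurable_extT_right (hM : M.ContinuityCompactness) (n : Fin N) (y : ExtState E)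
    (a : M.admissible n y.1) : Measurable (M.extT n y a) :=
  (measurable_extT hM n).comp (g := _)
    (f := fun z => ((⟨(y, a), a.2⟩ : {p : ExtState E × A // p.2 ∈ M.admissible n p.1.1}), z))
    (measurable_const.prodMk measurable_id)

end Measurability

section Semicontinuity

variable {E A 𝒵 Ω : Type*}
  [TopologicalSpace E] [TopologicalSpace.MetrizableSpace E] [SecondCountableTopology E]
  [MeasurableSpace E] [BorelSpace E]
  [TopologicalSpace A] [TopologicalSpace.MetrizableSpace A] [SecondCountableTopology A]
  [MeasurableSpace A] [BorelSpace A]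
  [MeasurableSpace 𝒵] [MeasurableSpace Ω]
  {P : Measure Ω} {N : ℕ} {M : DecisionModel E A 𝒵 P N} {g : ℝ → ℝ}

/-- The operator `L_n` preserves lower semicontinuity on the graph of the admissible actions. -/
theorem lowerSemicontinuous_opL (hM : M.ContinuityCompactness) (n : Fin N)
    {v : ExtState E → ℝ≥0∞} (hv : v ∈ valueClass g) :
    LowerSemicontinuous fun q : {p : ExtState E × A // p.2 ∈ M.admissible n p.1.1} =>
      M.opL n v q.1.1 ⟨q.1.2, q.2⟩ := by
  have : FirstCountableTopology {p : ExtState E × A // p.2 ∈ M.admissible n p.1.1} :=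
    Topology.IsInducing.subtypeVal.firstCountableTopology
  refine LowerSemicontinuous.lintegral
    (fun q => hv.1.measurable.comp ((measurable_extT_right hM n _ _).comp (M.measurable_Z n)))
    fun ω => ?_
  have hp : Continuous fun q : {p : ExtState E × A // p.2 ∈ M.admissible n p.1.1} =>
      (⟨(q.1.1.1, q.1.2), q.2⟩ : M.D n) := Continuous.subtype_mk (by fun_prop) _
  have hT := (hM.continuous_T n (M.Z n ω)).comp hp
  have ht : Continuous fun q : {p : ExtState E × A // p.2 ∈ M.admissible n p.1.1} =>
      (q.1.1.2.2 : ℝ≥0) := continuous_subtype_val.comp (by fun_prop)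
  exact hv.1.comp_extState hv.2.1 hT
    (lowerSemicontinuous_add_mul (by fun_prop) ht
      ((hM.lowerSemicontinuous_c n).comp (hp.prodMk hT)))
    (Continuous.subtype_mk (continuous_const.mul ht) _)

theorem lowerSemicontinuousOn_opLExt (hM : M.ContinuityCompactness) (n : Fin N)
    {v : ExtState E → ℝ≥0∞} (hv : v ∈ valueClass g) :
    LowerSemicontinuousOn (fun p : ExtState E × A => M.opLExt n v p.1 p.2)
      {p | p.2 ∈ M.admissible n p.1.1} := by
  rw [← lowerSemicontinuous_restrict_iff]
  convert lowerSemicontinuous_opL hM n hv using 2 with q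
  exact opLExt_coe n v q.1.1 ⟨q.1.2, q.2⟩

/-- The Bellman operator preserves the class `𝕄`. -/
theorem bellman_mem_valueClass [IsProbabilityMeasure P] (hM : M.ContinuityCompactness)
    (hg : Monotone g) (n : Fin N) {v : ExtState E → ℝ≥0∞} (hv : v ∈ valueClass g) :
    M.bellman n v ∈ valueClass g := by
  refine ⟨?_, fun x p q hpq => ?_, fun x s t => ?_⟩
  · have := lowerSemicontinuous_iInf_mem
      (K := fun y : ExtState E => M.admissible n y.1) (fun y => hM.isCompact_admissible n y.1)
      (fun y => M.admissible_nonempty n y.1) (exists_mapClusterPt_admissible hM n)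
      (lowerSemicontinuousOn_opLExt hM n hv)
    simp only [opLExt_coe] at this
    exact this
  · exact iInf_mono fun a => lintegral_mono fun ω => hv.2.1 _ (M.extT_mono n x a _ hpq)
  · refine le_iInf fun a => ?_
    calc ENNReal.ofReal (g s) = ∫⁻ _, ENNReal.ofReal (g s) ∂P := by simp
      _ ≤ _ := lintegral_mono fun ω => ?_
    refine le_trans (ENNReal.ofReal_le_ofReal (hg ?_)) (hv.2.2 _ _ _)
    exact NNReal.coe_le_coe.2 le_self_add

/-- Measurable minimizers exist in the Bellman equation. -/
theorem exists_opRule_eq_bellman (hM : M.ContinuityCompactness) (n : Fin N)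
    {v : ExtState E → ℝ≥0∞} (hv : v ∈ valueClass g) :
    ∃ d : M.MarkovRule n, M.opRule n d v = M.bellman n v := by
  obtain ⟨d, hd, hmin⟩ := exists_measurable_minimizer
    (K := fun y : ExtState E => M.admissible n y.1) (fun y => hM.isCompact_admissible n y.1)
    (fun y => M.admissible_nonempty n y.1) (exists_mapClusterPt_admissible hM n)
    (lowerSemicontinuousOn_opLExt hM n hv)
  refine ⟨⟨d, hd, fun y => (hmin y).1⟩, funext fun y => le_antisymm (le_iInf fun a => ?_)
    (iInf_le _ _)⟩
  have := (hmin y).2 a a.2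
  rw [opLExt_coe, opLExt_coe n v y ⟨d y, (hmin y).1⟩] at this
  exact this

end Semicontinuity

end DecisionModel

/-! ### The history process -/

theorem ProbabilityTheory.IndepFun.lintegral_eq_lintegral_lintegral {Ω 𝒳 𝒵 : Type*}
    [MeasurableSpace Ω] [MeasurableSpace 𝒳] [MeasurableSpace 𝒵] {P : Measure Ω}
    [IsProbabilityMeasure P] {X : Ω → 𝒳} {Z : Ω → 𝒵} (h : IndepFun X Z P) (hX : Measurable X)
    (hZ : Measurable Z) {F : 𝒳 × 𝒵 → ℝ≥0∞} (hF : Measurable F) :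
    ∫⁻ ω, F (X ω, Z ω) ∂P = ∫⁻ ω, ∫⁻ ω', F (X ω, Z ω') ∂P ∂P := by
  have := Measure.isProbabilityMeasure_map (μ := P) hX.aemeasurable
  have := Measure.isProbabilityMeasure_map (μ := P) hZ.aemeasurable
  rw [← lintegral_map hF (hX.prodMk hZ),
    h.map_prod_eq_prod_map_map hX.aemeasurable hZ.aemeasurable, lintegral_prod _ hF.aemeasurable,
    lintegral_map hF.lintegral_prod_right' hX]
  exact lintegral_congr fun ω => lintegral_map (hF.comp measurable_prodMk_left) hZ

namespace DecisionModel

section HistoryProcess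

variable {E A 𝒵 Ω : Type*} [MeasurableSpace E] [MeasurableSpace A] [MeasurableSpace 𝒵]
  [MeasurableSpace Ω] {P : Measure Ω} {N : ℕ} {M : DecisionModel E A 𝒵 P N}

@[simp]
theorem last_append (n : Fin N) (h : M.Hist n) (a : M.admissible n h.last.1) (y : ExtState E) :
    (M.append n h a y).last = y := by
  simp [append, Hist.last]

theorem measurable_last (n : ℕ) : Measurable fun h : M.Hist n => h.last :=
  (measurable_pi_apply (Fin.last n)).comp (measurable_fst.comp measurable_subtype_coe)

theorem last_histProcess_succ (π : M.Policy) (n : ℕ) (h : M.Hist n) (ω : Ω) (j : ℕ)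
    (hj : n + (j + 1) ≤ N) :
    (histProcess π n h ω (j + 1) hj).last =
      M.extT ⟨n + j, hj⟩ (histProcess π n h ω j (Nat.le_of_succ_le hj)).last
        ⟨(π ⟨n + j, hj⟩).toFun (histProcess π n h ω j (Nat.le_of_succ_le hj)),
          (π ⟨n + j, hj⟩).mem _⟩ (M.Z ⟨n + j, hj⟩ ω) :=
  last_append _ _ _ _

theorem last_histProcess_discount (π : M.Policy) (n : ℕ) (h : M.Hist n) (ω : Ω) (j : ℕ)
    (hj : n + j ≤ N) :
    ((histProcess π n h ω j hj).last.2.2 : ℝ≥0) = M.β ^ j * (h.last.2.2 : ℝ≥0) := by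
  induction j with
  | zero => simp [histProcess]
  | succ j ih =>
    rw [last_histProcess_succ]
    simp only [extT]
    rw [ih, pow_succ']
    ring

/-- The second component of the extended state accumulates the discounted costs. -/
theorem last_histProcess_cost (π : M.Policy) (n : ℕ) (h : M.Hist n) (ω : Ω) (j : ℕ)
    (hj : n + j ≤ N) :
    (histProcess π n h ω j hj).last.2.1 = h.last.2.1 + (h.last.2.2 : ℝ≥0) * ∑ i : Fin j,
      M.β ^ (i : ℕ) * M.c ⟨n + i, by omega⟩
        (⟨((histProcess π n h ω i (by omega)).last.1,
            (π ⟨n + i, by omega⟩).toFun (histProcess π n h ω i (by omega))),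
          (π ⟨n + i, by omega⟩).mem (histProcess π n h ω i (by omega))⟩,
          (histProcess π n h ω (i + 1) (by omega)).last.1) := by
  induction j with
  | zero => simp [histProcess]
  | succ j ih =>
    have hstep := last_histProcess_succ π n h ω j hj
    have hfst := congrArg Prod.fst hstep
    rw [Fin.sum_univ_castSucc, mul_add, ← add_assoc h.last.2.1]
    refine (congrArg (fun y => y.2.1) hstep).trans
      (congrArg₂ (· + ·) (ih (Nat.le_of_succ_le hj)) ?_)
    rw [last_histProcess_discount, mul_comm (M.β ^ j), mul_assoc]
    exact congrArg (fun x => (h.last.2.2 : ℝ≥0) * (M.β ^ j * M.c ⟨n + j, hj⟩ (_, x))) hfst.symm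

/-- As the extended state keeps track of the accumulated costs, the value of a policy is the
expected terminal value of the final extended state. -/
theorem policyValue_eq_lintegral_terminalValue (g : ℝ → ℝ) (π : M.Policy) (n : ℕ) (hn : n ≤ N)
    (h : M.Hist n) :
    policyValue g π n hn h =
      ∫⁻ ω, M.terminalValue g (histProcess π n h ω (N - n) (by omega)).last ∂P := by
  refine lintegral_congr fun ω => ?_
  simp only [terminalValue]
  rw [last_histProcess_cost, last_histProcess_discount, costToGo, mul_add, ← add_assoc,
    mul_left_comm, ← mul_assoc (M.β ^ (N - n))]

/-- The σ-algebra generated by the disturbances `Z i`, `i < k`. -/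
abbrev disturbanceσ (M : DecisionModel E A 𝒵 P N) (k : ℕ) : MeasurableSpace Ω :=
  ⨆ i ∈ {i : Fin N | (i : ℕ) < k}, MeasurableSpace.comap (M.Z i) inferInstance

theorem disturbanceσ_le (M : DecisionModel E A 𝒵 P N) (k : ℕ) :
    M.disturbanceσ k ≤ ‹MeasurableSpace Ω› :=
  iSup₂_le fun i _ => (M.measurable_Z i).comap_le

theorem disturbanceσ_mono (M : DecisionModel E A 𝒵 P N) {k l : ℕ} (h : k ≤ l) :
    M.disturbanceσ k ≤ M.disturbanceσ l :=
  biSup_mono fun _ hi => lt_of_lt_of_le hi h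

theorem measurable_Z_disturbanceσ (M : DecisionModel E A 𝒵 P N) (n : Fin N) {k : ℕ}
    (h : (n : ℕ) < k) : Measurable[M.disturbanceσ k] (M.Z n) :=
  measurable_iff_comap_le.2 (le_iSup₂_of_le n h le_rfl)

theorem indep_disturbanceσ (M : DecisionModel E A 𝒵 P N) (n : Fin N) :
    Indep (M.disturbanceσ n) (MeasurableSpace.comap (M.Z n) inferInstance) P := by
  have := indep_iSup_of_disjoint (fun i => (M.measurable_Z i).comap_le) M.indep_Z.iIndep
    (S := {i : Fin N | (i : ℕ) < n}) (T := {n}) (by simp)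
  rwa [iSup_singleton] at this

end HistoryProcess

section Measurability

variable {E A 𝒵 Ω : Type*}
  [TopologicalSpace E] [SecondCountableTopology E] [MeasurableSpace E] [BorelSpace E]
  [TopologicalSpace A] [SecondCountableTopology A] [MeasurableSpace A] [BorelSpace A]
  [MeasurableSpace 𝒵] [MeasurableSpace Ω]
  {P : Measure Ω} {N : ℕ} {M : DecisionModel E A 𝒵 P N}

theorem measurable_extT_rule (hM : M.ContinuityCompactness) (n : Fin N) (d : M.Rule n) :
    Measurable fun q : M.Hist n × 𝒵 => M.extT n q.1.last ⟨d.toFun q.1, d.mem q.1⟩ q.2 := by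
  have h : Measurable fun q : M.Hist n × 𝒵 =>
      ((⟨(q.1.last, d.toFun q.1), d.mem q.1⟩ :
        {p : ExtState E × A // p.2 ∈ M.admissible n p.1.1}), q.2) :=
    (Measurable.subtype_mk (((measurable_last _).comp measurable_fst).prodMk
      (d.measurable.comp measurable_fst))).prodMk measurable_snd
  exact (measurable_extT hM n).comp h

theorem measurable_append_rule (hM : M.ContinuityCompactness) (n : Fin N) (d : M.Rule n) :
    Measurable fun q : M.Hist n × 𝒵 => M.append n q.1 ⟨d.toFun q.1, d.mem q.1⟩
      (M.extT n q.1.last ⟨d.toFun q.1, d.mem q.1⟩ q.2) := by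
  refine Measurable.subtype_mk (Measurable.prodMk ?_ ?_)
  · refine measurable_pi_iff.2 fun i => Fin.lastCases ?_ (fun i => ?_) i
    · simpa only [Fin.snoc_last] using measurable_extT_rule hM n d
    · simp only [Fin.snoc_castSucc]
      exact (measurable_pi_apply i).comp
        (measurable_fst.comp (measurable_subtype_coe.comp measurable_fst))
  · refine measurable_pi_iff.2 fun i => Fin.lastCases ?_ (fun i => ?_) i
    · simp only [Fin.snoc_last]
      exact d.measurable.comp measurable_fst
    · simp only [Fin.snoc_castSucc]
      exact (measurable_pi_apply i).comp
        (measurable_snd.comp (measurable_subtype_coe.comp measurable_fst))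

/-- The history at time `n + j` is a function of the disturbances up to that time. -/
theorem measurable_histProcess (hM : M.ContinuityCompactness) (π : M.Policy) (n : ℕ)
    (h : M.Hist n) (j : ℕ) (hj : n + j ≤ N) :
    Measurable[M.disturbanceσ (n + j)] fun ω => histProcess π n h ω j hj := by
  induction j with
  | zero => exact measurable_const
  | succ j ih =>
    exact (measurable_append_rule hM ⟨n + j, hj⟩ (π ⟨n + j, hj⟩)).comp
      (((ih _).mono (M.disturbanceσ_mono (Nat.le_succ _)) le_rfl).prodMk
        (M.measurable_Z_disturbanceσ ⟨n + j, hj⟩ (Nat.lt_succ_self _)))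

/-- One step of the history process: as the disturbance driving the step is independent of the
history, it can be integrated out first. -/
theorem lintegral_last_histProcess_succ [IsProbabilityMeasure P] (hM : M.ContinuityCompactness)
    (π : M.Policy) (n : ℕ) (h : M.Hist n) (j : ℕ) (hj : n + (j + 1) ≤ N)
    {v : ExtState E → ℝ≥0∞} (hv : Measurable v) :
    ∫⁻ ω, v (histProcess π n h ω (j + 1) hj).last ∂P =
      ∫⁻ ω, M.opL ⟨n + j, hj⟩ v (histProcess π n h ω j (Nat.le_of_succ_le hj)).last
        ⟨(π ⟨n + j, hj⟩).toFun (histProcess π n h ω j (Nat.le_of_succ_le hj)),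
          (π ⟨n + j, hj⟩).mem _⟩ ∂P := by
  have hmeas := measurable_histProcess hM π n h j (Nat.le_of_succ_le hj)
  have hind : IndepFun (fun ω => histProcess π n h ω j (Nat.le_of_succ_le hj))
      (M.Z ⟨n + j, hj⟩) P := by
    rw [IndepFun_iff_Indep]
    exact indep_of_indep_of_le_left (M.indep_disturbanceσ ⟨n + j, hj⟩) hmeas.comap_le
  simp only [last_histProcess_succ]
  exact hind.lintegral_eq_lintegral_lintegral (hmeas.mono (M.disturbanceσ_le _) le_rfl)
    (M.measurable_Z _) (hv.comp (measurable_extT_rule hM ⟨n + j, hj⟩ (π ⟨n + j, hj⟩)))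

end Measurability

end DecisionModel

/-! ### Backward induction -/

namespace DecisionModel

section BackwardInduction

variable {E A 𝒵 Ω : Type*} [MeasurableSpace E] [MeasurableSpace A] [MeasurableSpace 𝒵]
  [MeasurableSpace Ω] {P : Measure Ω} {N : ℕ} {M : DecisionModel E A 𝒵 P N}

/-- The functions obtained by backward induction with the Bellman operators from the terminal
value. -/
noncomputable def bellmanValue (M : DecisionModel E A 𝒵 P N) (g : ℝ → ℝ) (n : ℕ) :
    ExtState E → ℝ≥0∞ :=
  if hn : n < N then M.bellman ⟨n, hn⟩ (bellmanValue M g (n + 1)) else M.terminalValue g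
termination_by N - n

theorem bellmanValue_of_lt (g : ℝ → ℝ) {n : ℕ} (hn : n < N) :
    M.bellmanValue g n = M.bellman ⟨n, hn⟩ (M.bellmanValue g (n + 1)) := by
  rw [bellmanValue, dif_pos hn]

theorem bellmanValue_of_le (g : ℝ → ℝ) {n : ℕ} (hn : N ≤ n) :
    M.bellmanValue g n = M.terminalValue g := by
  rw [bellmanValue, dif_neg hn.not_gt]

theorem opRule_mono (n : Fin N) (d : M.MarkovRule n) {v w : ExtState E → ℝ≥0∞} (h : v ≤ w) :
    M.opRule n d v ≤ M.opRule n d w :=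
  fun _ => lintegral_mono fun _ => h _

theorem bellmanValue_le_markovPolicyValue (g : ℝ → ℝ) (π : M.MarkovPolicy) (n : ℕ) :
    M.bellmanValue g n ≤ M.markovPolicyValue g π n := by
  rw [bellmanValue, markovPolicyValue]
  split_ifs with hn
  · exact (bellman_le_opRule _ (π ⟨n, hn⟩) _).trans
      (opRule_mono _ _ (bellmanValue_le_markovPolicyValue g π (n + 1)))
  · exact le_rfl
termination_by N - n

theorem markovPolicyValue_eq_bellmanValue (g : ℝ → ℝ) (π : M.MarkovPolicy)
    (hπ : ∀ n : Fin N, M.opRule n (π n) (M.bellmanValue g (n + 1)) =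
      M.bellman n (M.bellmanValue g (n + 1))) (n : ℕ) :
    M.markovPolicyValue g π n = M.bellmanValue g n := by
  rw [bellmanValue, markovPolicyValue]
  split_ifs with hn
  · rw [markovPolicyValue_eq_bellmanValue g π hπ (n + 1)]
    exact hπ ⟨n, hn⟩
  · rfl
termination_by N - n

end BackwardInduction

section Optimality

variable {E A 𝒵 Ω : Type*}
  [TopologicalSpace E] [TopologicalSpace.MetrizableSpace E] [SecondCountableTopology E]
  [MeasurableSpace E] [BorelSpace E]
  [TopologicalSpace A] [TopologicalSpace.MetrizableSpace A] [SecondCountableTopology A]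
  [MeasurableSpace A] [BorelSpace A]
  [MeasurableSpace 𝒵] [MeasurableSpace Ω]
  {P : Measure Ω} [IsProbabilityMeasure P] {N : ℕ} {M : DecisionModel E A 𝒵 P N} {g : ℝ → ℝ}

theorem bellmanValue_mem_valueClass (hM : M.ContinuityCompactness) (hg_mono : Monotone g)
    (hg : Continuous g) (n : ℕ) : M.bellmanValue g n ∈ valueClass g := by
  rw [bellmanValue]
  split_ifs with hn
  · exact bellman_mem_valueClass hM hg_mono _ (bellmanValue_mem_valueClass hM hg_mono hg (n + 1))
  · exact terminalValue_mem_valueClass hM hg_mono hg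
termination_by N - n

theorem exists_markovPolicy_minimizing (hM : M.ContinuityCompactness) (hg_mono : Monotone g)
    (hg : Continuous g) : ∃ π : M.MarkovPolicy, ∀ n : Fin N,
      M.opRule n (π n) (M.bellmanValue g (n + 1)) = M.bellman n (M.bellmanValue g (n + 1)) :=
  Classical.skolem.1 fun n : Fin N =>
    exists_opRule_eq_bellman hM n (bellmanValue_mem_valueClass hM hg_mono hg (n + 1))

theorem markovValue_eq_bellmanValue (hM : M.ContinuityCompactness) (hg_mono : Monotone g)
    (hg : Continuous g) (n : ℕ) : M.markovValue g n = M.bellmanValue g n := by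
  obtain ⟨π, hπ⟩ := exists_markovPolicy_minimizing hM hg_mono hg
  refine funext fun y => le_antisymm ?_
    (le_iInf fun π => bellmanValue_le_markovPolicyValue g π n y)
  rw [← markovPolicyValue_eq_bellmanValue g π hπ n]
  exact iInf_le _ π

/-- Under every policy, the expected Bellman value along the history process is at least the
initial one. -/
theorem bellmanValue_le_lintegral_histProcess (hM : M.ContinuityCompactness)
    (hg_mono : Monotone g) (hg : Continuous g) (π : M.Policy) (n : ℕ) (h : M.Hist n) (j : ℕ)
    (hj : n + j ≤ N) : M.bellmanValue g n h.last ≤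
      ∫⁻ ω, M.bellmanValue g (n + j) (histProcess π n h ω j hj).last ∂P := by
  induction j with
  | zero => simp [histProcess]
  | succ j ih =>
    refine (ih (Nat.le_of_succ_le hj)).trans ?_
    rw [lintegral_last_histProcess_succ hM π n h j hj
      (bellmanValue_mem_valueClass hM hg_mono hg _).1.measurable,
      bellmanValue_of_lt (n := n + j) g hj]
    exact lintegral_mono fun ω => iInf_le _ _

/-- Under a Markov policy of minimizers, the expected Bellman value along the history process is
constant. -/
theorem bellmanValue_eq_lintegral_histProcess (hM : M.ContinuityCompactness)
    (hg_mono : Monotone g) (hg : Continuous g) (π : M.MarkovPolicy)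
    (hπ : ∀ n : Fin N, M.opRule n (π n) (M.bellmanValue g (n + 1)) =
      M.bellman n (M.bellmanValue g (n + 1))) (n : ℕ) (h : M.Hist n) (j : ℕ)
    (hj : n + j ≤ N) : M.bellmanValue g n h.last =
      ∫⁻ ω, M.bellmanValue g (n + j) (histProcess π.toPolicy n h ω j hj).last ∂P := by
  induction j with
  | zero => simp [histProcess]
  | succ j ih =>
    rw [ih (Nat.le_of_succ_le hj), lintegral_last_histProcess_succ hM π.toPolicy n h j hj
      (bellmanValue_mem_valueClass hM hg_mono hg _).1.measurable,
      bellmanValue_of_lt (n := n + j) g hj]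
    exact lintegral_congr fun ω => (congrFun (hπ ⟨n + j, hj⟩) _).symm

theorem bellmanValue_le_policyValue (hM : M.ContinuityCompactness) (hg_mono : Monotone g)
    (hg : Continuous g) (π : M.Policy) (n : ℕ) (hn : n ≤ N) (h : M.Hist n) :
    M.bellmanValue g n h.last ≤ policyValue g π n hn h := by
  rw [policyValue_eq_lintegral_terminalValue]
  refine (bellmanValue_le_lintegral_histProcess hM hg_mono hg π n h (N - n) (by omega)).trans_eq ?_
  rw [bellmanValue_of_le g (by omega)]

theorem policyValue_eq_bellmanValue (hM : M.ContinuityCompactness) (hg_mono : Monotone g)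
    (hg : Continuous g) (π : M.MarkovPolicy)
    (hπ : ∀ n : Fin N, M.opRule n (π n) (M.bellmanValue g (n + 1)) =
      M.bellman n (M.bellmanValue g (n + 1))) (n : ℕ) (hn : n ≤ N) (h : M.Hist n) :
    policyValue g π.toPolicy n hn h = M.bellmanValue g n h.last := by
  rw [policyValue_eq_lintegral_terminalValue,
    bellmanValue_eq_lintegral_histProcess hM hg_mono hg π hπ n h (N - n) (by omega),
    bellmanValue_of_le g (by omega)]

theorem value_eq_bellmanValue (hM : M.ContinuityCompactness) (hg_mono : Monotone g)
    (hg : Continuous g) (n : ℕ) (hn : n ≤ N) (h : M.Hist n) :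
    M.value g n hn h = M.bellmanValue g n h.last := by
  obtain ⟨π, hπ⟩ := exists_markovPolicy_minimizing hM hg_mono hg
  refine le_antisymm ?_
    (le_iInf fun π => bellmanValue_le_policyValue hM hg_mono hg π n hn h)
  rw [← policyValue_eq_bellmanValue hM hg_mono hg π hπ n hn h]
  exact iInf_le _ _

end Optimality

end DecisionModel

theorem theorem4p4
    {E A 𝒵 Ω : Type*}
    [TopologicalSpace E] [TopologicalSpace.MetrizableSpace E] [SecondCountableTopology E]
    [MeasurableSpace E] [BorelSpace E] [StandardBorelSpace E]
    [TopologicalSpace A] [TopologicalSpace.MetrizableSpace A] [SecondCountableTopology A]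
    [MeasurableSpace A] [BorelSpace A] [StandardBorelSpace A]
    [MeasurableSpace 𝒵] [MeasurableSpace Ω]
    (P : Measure Ω) [IsProbabilityMeasure P]
    (N : ℕ) (M : DecisionModel E A 𝒵 P N) (hM : M.ContinuityCompactness)
    (g : ℝ → ℝ) (hg_mono : Monotone g) (hg_conv : ConvexOn ℝ Set.univ g) (hg_nonneg : 0 ≤ g 0) :
    -- the value functions depend on the current extended state only
    (∀ (n : ℕ) (hn : n ≤ N) (h : M.Hist n), M.value g n hn h = M.markovValue g n h.last) ∧
    -- they lie in the class `𝕄`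
    (∀ n ≤ N, M.markovValue g n ∈ valueClass g) ∧
    -- Bellman equation
    (∀ (x : E) (s : ℝ≥0) (t : Set.Ioi (0 : ℝ≥0)),
      M.markovValue g N (x, s, t) = ENNReal.ofReal (g ((s : ℝ) + (t : ℝ≥0) * M.cN x))) ∧
    (∀ n : Fin N, M.markovValue g n = M.bellman n (M.markovValue g (n + 1))) ∧
    -- existence of minimizing Markov decision rules
    (∀ n : Fin N, ∃ d : M.MarkovRule n,
      M.opRule n d (M.markovValue g (n + 1)) = M.bellman n (M.markovValue g (n + 1))) ∧
    -- every sequence of minimizers is an optimal policy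
    (∀ π : M.MarkovPolicy,
      (∀ n : Fin N, M.opRule n (π n) (M.markovValue g (n + 1)) =
        M.bellman n (M.markovValue g (n + 1))) →
      ∀ (n : ℕ) (hn : n ≤ N) (h : M.Hist n),
        DecisionModel.policyValue g π.toPolicy n hn h = M.value g n hn h) := by
  have hg := hg_conv.continuous_of_univ
  have hJ := fun n => DecisionModel.markovValue_eq_bellmanValue hM hg_mono hg n
  simp only [hJ]
  refine ⟨fun n hn h => DecisionModel.value_eq_bellmanValue hM hg_mono hg n hn h,
    fun n _ => DecisionModel.bellmanValue_mem_valueClass hM hg_mono hg n, fun x s t => ?_,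
    fun n => DecisionModel.bellmanValue_of_lt g n.2,
    fun n => DecisionModel.exists_opRule_eq_bellman hM n
      (DecisionModel.bellmanValue_mem_valueClass hM hg_mono hg _), fun π hπ n hn h => ?_⟩
  · rw [DecisionModel.bellmanValue_of_le g le_rfl, DecisionModel.terminalValue]
    push_cast
    rfl
  · rw [DecisionModel.value_eq_bellmanValue hM hg_mono hg,
      DecisionModel.policyValue_eq_bellmanValue hM hg_mono hg π hπ]
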